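/- Fix a limit ordinal $\rho$. Let $\mathbb{T}$ be the category whose objects are pairs $(\mathcal{E};\vartheta)$ of a finite set $\mathcal{E}$ of clock names (taken from a fixed countably infinite set) and a map $\vartheta:\mathcal{E}\to\rho$, and whose morphisms $(\mathcal{E};\vartheta)\to(\mathcal{E}';\vartheta')$ are maps $\sigma:\mathcal{E}\to\mathcal{E}'$ with $\vartheta'\circ\sigma\le\vartheta$. Presheaves are covariant. Let $\mathrm{Clk}(\mathcal{E};\vartheta)=\mathcal{E}$, and for a finite set $\Delta$ of clock variables let $\mathrm{GR}_\Delta$ be the category of presheaves on the category of elements $\int\mathrm{Clk}^\Delta$, whose objects are the triples $(\mathcal{E};\vartheta;f:\Delta\to\mathcal{E})$. For $\Gamma$ in $\mathrm{GR}_\Delta$, a type over $\Gamma$ is a presheaf on $\int\Gamma$. An object of $\mathrm{GR}_\Delta$, or a type over an object of $\mathrm{GR}_\Delta$, is invariant under clock introduction if each inclusion $\iota:(\mathcal{E};\vartheta)\to(\mathcal{E}\cup\{\lambda\};\vartheta[\lambda\mapsto\alpha])$ with $\lambda\notin\mathcal{E}$ acts on it bijectively. A family over $\Gamma$ is a type over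 $\Gamma$ that is invariant under clock introduction, and a predicate on $\Gamma$ is a family over $\Gamma$ all of whose fibres are subsingletons. For $s:\Gamma\to\Gamma'$ and a type $A$ over $\Gamma'$, $A[s]$ is the reindexing of $A$ along $s$. For $\kappa\in\Delta$ let $(\triangleright^\kappa X)(\mathcal{E};\vartheta;f)=\lim_{\alpha<\vartheta(f(\kappa))}X(\mathcal{E};\vartheta[f(\kappa)\mapsto\alpha];f)$, with canonical map $\mathsf{next}:X\to\triangleright^\kappa X$. For a type $A$ over $\Gamma$, let $\triangleright^\kappa A$ be the type over $\triangleright^\kappa\Gamma$ whose fibre over $(\gamma_\alpha)_\alpha$ is $\lim_{\alpha<\vartheta(f(\kappa))}A(\mathcal{E};\vartheta[f(\kappa)\mapsto\alpha];f;\gamma_\alpha)$. For a type $A$ over $\Gamma$ write $\Gamma.A$ for the context extension, $(\Gamma.A)(x)=\{(\gamma,a)\mid\gamma\in\Gamma(x),\ a\in A(x;\gamma)\}$. For $\kappa\notin\Delta$ and $\Gamma$ in $\mathrm{GR}_\Delta$, write $\Gamma\times\mathrm{Clk}$ for the object $(\mathcal{E};\vartheta;f)\mapsto\Gamma(\mathcal{E};\vartheta;f|_\Delta)$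 of $\mathrm{GR}_{\Delta\cup\{\kappa\}}$. **Proposition 4.2.** There are, for all finite sets $\Delta$ of clock variables, objects $\mathrm{Prop}_\Delta$ of $\mathrm{GR}_\Delta$ and predicates $\mathrm{PEl}_\Delta$ on $\mathrm{Prop}_\Delta$ such that, for every $\Delta$: 1. $\mathrm{Prop}_\Delta$ is invariant under clock introduction. 2. For any $\Gamma$ in $\mathrm{GR}_\Delta$ that is invariant under clock introduction and any predicate $A$ on $\Gamma$, there is a unique map $c:\Gamma\to\mathrm{Prop}_\Delta$ (the code of $A$) such that $A\cong\mathrm{PEl}_\Delta[c]$. Moreover, for any $\Gamma$ in $\mathrm{GR}_\Delta$, invariant or not, two maps $c,d:\Gamma\to\mathrm{Prop}_\Delta$ with $\mathrm{PEl}_\Delta[c]\cong\mathrm{PEl}_\Delta[d]$ are equal. 3. The universe is closed under the following operations, where $\Gamma$ is any object of $\mathrm{GR}_\Delta$, and where a type over $\Gamma$ is said to have a code if it is isomorphic to $\mathrm{PEl}_\Delta[c]$ for some $c:\Gamma\to\mathrm{Prop}_\Delta$: - Quantification over families: let $\Gamma_0$ in $\mathrm{GR}_\Delta$ be invariant under clock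 introduction, $A$ a family over $\Gamma_0$, $s:\Gamma\to\Gamma_0$, $b:\Gamma.A[s]\to\mathrm{Prop}_\Delta$ and $B=\mathrm{PEl}_\Delta[b]$. Then the dependent product $\forall(A[s],B)$ and the type $\exists(A[s],B)$, whose fibre over $\gamma$ is the subset of $\{\star\}$ that is inhabited iff some fibre of $B$ over $(\gamma,a)$ is, have codes. - If $(b_i)_{i\in I}$ is a finite family of maps $\Gamma\to\mathrm{Prop}_\Delta$, then the conjunction and the disjunction of the predicates $\mathrm{PEl}_\Delta[b_i]$ have codes. - For $\kappa\notin\Delta$ and $b:\Gamma\times\mathrm{Clk}\to\mathrm{Prop}_{\Delta\cup\{\kappa\}}$, the type $\forall\kappa.\,\mathrm{PEl}_{\Delta\cup\{\kappa\}}[b]$ over $\Gamma$, i.e. the dependent product along the projection from $\Gamma\times\mathrm{Clk}$ to $\Gamma$, has a code. - For $\kappa\in\Delta$ and $b:\Gamma\to\mathrm{Prop}_\Delta$, the type $(\triangleright^\kappa(\mathrm{PEl}_\Delta[b]))[\mathsf{next}]$ over $\Gamma$ has a code. More generally, for $b:\Gamma\to\triangleright^\kappa\mathrm{Prop}_\Delta$,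 the type $(\triangleright^\kappa\mathrm{PEl}_\Delta)[b]$ has a code. -/

import Mathlib

open CategoryTheory

universe u

namespace ClockModel

/-- A time object: a finite set `clocks` of clock names (the clock names are the natural numbers)
together with a map `time` from it to the ordinals below `ρ`. -/
structure TimeObj (ρ : Ordinal.{u}) : Type u where
  clocks : Finset ℕ
  time : clocks → ρ.ToType

/-- A morphism of time objects: a map `σ` of clocks such that `t.time ∘ σ ≤ s.time`. -/
@[ext]
structure TimeHom {ρ : Ordinal.{u}} (s t : TimeObj ρ) where
  fn : s.clocks → t.clocks
  time_le : ∀ x, t.time (fn x) ≤ s.time x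

/-- The category of time objects. -/
instance TimeObj.category (ρ : Ordinal.{u}) : Category (TimeObj ρ) where
  Hom s t := TimeHom s t
  id s := ⟨id, fun _ => le_rfl⟩
  comp σ τ := ⟨τ.fn ∘ σ.fn, fun x => (τ.time_le _).trans (σ.time_le x)⟩

/-- The morphism `σ` is an inclusion `(E, ϑ) → (E ∪ {κ}, ϑ[κ ↦ α])` with `κ ∉ E`. -/
def IsClockIntro {ρ : Ordinal.{u}} {s t : TimeObj ρ} (σ : s ⟶ t) : Prop :=
  ∃ κ : ℕ, κ ∉ s.clocks ∧ t.clocks = insert κ s.clocks ∧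
    ∀ x : s.clocks, (σ.fn x : ℕ) = x ∧ t.time (σ.fn x) = s.time x

/-- The covariant presheaf `Clk^Δ`, the `Δ`-fold power of the object of clocks
`(E, ϑ) ↦ E`. -/
def ClkPow (ρ : Ordinal.{u}) {V : Type u} (Δ : Finset V) : TimeObj ρ ⥤ Type u where
  obj t := Δ → t.clocks
  map σ := ↾(fun f => σ.fn ∘ f)

/-- The category of elements of `Clk^Δ`: objects are `(E, ϑ, f : Δ → E)`. -/
abbrev Base (ρ : Ordinal.{u}) {V : Type u} (Δ : Finset V) : Type u := (ClkPow ρ Δ).Elements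

/-- The category of covariant presheaves on the category of elements of `Clk^Δ`. -/
abbrev GR (ρ : Ordinal.{u}) {V : Type u} (Δ : Finset V) := Base ρ Δ ⥤ Type u

/-- Invariance under clock introduction for a covariant presheaf `X` on a category `D` of elements
lying over the category of time objects by `p` : every clock introduction acts bijectively. -/
def ClockInvariant {ρ : Ordinal.{u}} {D : Type u} [Category D] (p : D ⥤ TimeObj ρ)
    (X : D ⥤ Type u) : Prop :=
  ∀ ⦃a b : D⦄ (g : a ⟶ b), IsClockIntro (p.map g) → Function.Bijective (X.map g)

section Generic

variable {C : Type u} [Category.{0} C]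

/-- A (semantic) dependent type over a covariant presheaf `Γ`: a presheaf on its elements. -/
abbrev Ty (Γ : C ⥤ Type u) := Γ.Elements ⥤ Type u

/-- Reindexing `A[s]` of a dependent type along a map `s`. -/
abbrev reindex {Γ Γ' : C ⥤ Type u} (s : Γ ⟶ Γ') (A : Ty Γ') : Ty Γ :=
  CategoryOfElements.map s ⋙ A

/-- The morphism of elements over `g` starting at `γ`. -/
abbrev liftHom {Γ : C ⥤ Type u} {x y : C} (g : x ⟶ y) (γ : Γ.obj x) :
    Γ.elementsMk x γ ⟶ Γ.elementsMk y (Γ.map g γ) := ⟨g, rfl⟩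

theorem map_heq {Γ : C ⥤ Type u} (A : Ty Γ) {x y : C} (γ : Γ.obj x)
    (g : x ⟶ y) (δ δ' : Γ.obj y) (h : Γ.map g γ = δ) (h' : Γ.map g γ = δ') (a : A.obj ⟨x, γ⟩) :
    HEq (A.map (⟨g, h⟩ : Γ.elementsMk x γ ⟶ Γ.elementsMk y δ) a)
      (A.map (⟨g, h'⟩ : Γ.elementsMk x γ ⟶ Γ.elementsMk y δ') a) := by
  subst h; subst h'; rfl

/-- The context extension `Γ.A`, whose elements at `x` are the pairs `(γ, a)`. -/
def compr (Γ : C ⥤ Type u) (A : Ty Γ) : C ⥤ Type u where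
  obj x := Σ γ : Γ.obj x, A.obj ⟨x, γ⟩
  map g := ↾(fun p => ⟨Γ.map g p.1, A.map (liftHom g p.1) p.2⟩)
  map_id x := by
    refine TypeCat.homEquiv.injective (funext fun ⟨γ, a⟩ => ?_)
    refine Sigma.ext (show Γ.map (𝟙 x) γ = _ from Γ.map_id_apply _ γ) ?_
    have h := map_heq A γ (𝟙 x) _ γ rfl (Γ.map_id_apply _ γ) a
    refine h.trans (heq_of_eq ?_)
    exact A.map_id_apply _ a
  map_comp {x y z} g h := by
    refine TypeCat.homEquiv.injective (funext fun ⟨γ, a⟩ => ?_)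
    refine Sigma.ext (show Γ.map (g ≫ h) γ = _ from Γ.map_comp_apply g h γ) ?_
    have e := map_heq A γ (g ≫ h) _ (Γ.map h (Γ.map g γ)) rfl (Γ.map_comp_apply g h γ) a
    refine e.trans (heq_of_eq ?_)
    exact A.map_comp_apply (liftHom g γ) (liftHom h (Γ.map g γ)) a

/-- The projection `Γ.A ⟶ Γ`. -/
def comprFst (Γ : C ⥤ Type u) (A : Ty Γ) : compr Γ A ⟶ Γ where
  app x := ↾(fun p => p.1)

/-- The element `(γ, a)` of `Γ.A`. -/
abbrev pair {Γ : C ⥤ Type u} {A : Ty Γ} (p : Γ.Elements) (a : A.obj p) : (compr Γ A).Elements :=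
  ⟨p.1, ⟨p.2, a⟩⟩

theorem compr_map {Γ : C ⥤ Type u} {A : Ty Γ} {x y : C} {γ : Γ.obj x} {δ : Γ.obj y}
    (g : x ⟶ y) (h : Γ.map g γ = δ) (a : A.obj ⟨x, γ⟩) :
    (compr Γ A).map g ⟨γ, a⟩ =
      ⟨δ, A.map (⟨g, h⟩ : Γ.elementsMk x γ ⟶ Γ.elementsMk y δ) a⟩ := by
  subst h; rfl

/-- The action of `g : p ⟶ q` on an element `(γ, a)` of `Γ.A` over `p`. -/
def pairMap {Γ : C ⥤ Type u} {A : Ty Γ} {p q : Γ.Elements} (g : p ⟶ q) (a : A.obj p) :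
    pair p a ⟶ pair q (A.map g a) :=
  ⟨g.1, compr_map g.1 g.2 a⟩

/-- Dependent product along a functor `F` of categories of elements: an element at `p` is a
natural family of elements of `B` at `r`, for all `r` and all `g : p ⟶ F r`. -/
def piAlong {D E : Type u} [Category.{0} D] [Category.{0} E] (F : D ⥤ E) (B : D ⥤ Type u) :
    E ⥤ Type u where
  obj p := {s : ∀ r : D, (p ⟶ F.obj r) → B.obj r //
    ∀ (r r' : D) (g : p ⟶ F.obj r) (h : r ⟶ r'), B.map h (s r g) = s r' (g ≫ F.map h)}
  map k := ↾(fun s => ⟨fun r g => s.1 r (k ≫ g), fun r r' g h => by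
    rw [s.2, Category.assoc]⟩)
  map_id p := by
    refine TypeCat.homEquiv.injective (funext fun s => Subtype.ext ?_)
    funext r g
    exact congrArg (s.1 r) (Category.id_comp g)
  map_comp k l := by
    refine TypeCat.homEquiv.injective (funext fun s => Subtype.ext ?_)
    funext r g
    exact congrArg (s.1 r) (Category.assoc k l g)

/-- Universal quantification (dependent product) `∀(A, B)` of `B` over `Γ.A`: an element at
`(x, γ)` assigns naturally to each `g : x ⟶ y` and `a ∈ A(y, g·γ)` an element of
`B(y, g·γ, a)`. -/
def forallTy {Γ : C ⥤ Type u} (A : Ty Γ) (B : Ty (compr Γ A)) : Ty Γ :=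
  piAlong (CategoryOfElements.map (comprFst Γ A)) B

/-- Existential quantification `∃(A, B)`: the fibre over `p` is the subset of the one-point set
that is inhabited iff the fibre of `B` over `(p, a)` is, for some `a` in the fibre of `A`. -/
def existsTy {Γ : C ⥤ Type u} (A : Ty Γ) (B : Ty (compr Γ A)) : Ty Γ where
  obj p := {_s : PUnit.{u + 1} // ∃ a : A.obj p, Nonempty (B.obj (pair p a))}
  map g := ↾(fun s => ⟨s.1, by
    obtain ⟨a, ⟨b⟩⟩ := s.2
    exact ⟨A.map g a, ⟨B.map (pairMap g a) b⟩⟩⟩)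

/-- The conjunction of a family of predicates (their fibrewise product). -/
def conjTy {Γ : C ⥤ Type u} {ι : Type} (B : ι → Ty Γ) : Ty Γ where
  obj p := ∀ i, (B i).obj p
  map g := ↾(fun s i => (B i).map g (s i))
  map_id p := by
    refine TypeCat.homEquiv.injective (funext fun s => funext fun i => ?_)
    exact (B i).map_id_apply _ (s i)
  map_comp g h := by
    refine TypeCat.homEquiv.injective (funext fun s => funext fun i => ?_)
    exact (B i).map_comp_apply g h (s i)

/-- The disjunction of a family of predicates: the fibre over `p` is the subset of the one-point
set that is inhabited iff the fibre of some member of the family is. -/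
def disjTy {Γ : C ⥤ Type u} {ι : Type} (B : ι → Ty Γ) : Ty Γ where
  obj p := {_s : PUnit.{u + 1} // ∃ i, Nonempty ((B i).obj p)}
  map g := ↾(fun s => ⟨s.1, by
    obtain ⟨i, ⟨b⟩⟩ := s.2
    exact ⟨i, ⟨(B i).map g b⟩⟩⟩)

end Generic

section Clocks

variable {ρ : Ordinal.{u}} {V : Type u} {Δ : Finset V}

/-- An object of `GR ρ Δ` is invariant under clock introduction. -/
def IsClockInvariant (X : GR ρ Δ) : Prop :=
  ClockInvariant (CategoryOfElements.π (ClkPow ρ Δ)) X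

/-- A family over `Γ`: a dependent type that is invariant under clock introduction. -/
def IsFamily {Γ : GR ρ Δ} (A : Ty Γ) : Prop :=
  ClockInvariant (CategoryOfElements.π Γ ⋙ CategoryOfElements.π (ClkPow ρ Δ)) A

/-- A predicate on `Γ`: a family all of whose fibres are subsingletons. -/
def IsPredicate {Γ : GR ρ Δ} (A : Ty Γ) : Prop :=
  IsFamily A ∧ ∀ p : Γ.Elements, Subsingleton (A.obj p)

/-- The time `ϑ(f(κ))` of the clock `κ ∈ Δ` at `(E, ϑ, f)`. -/
def clockTime (κ : Δ) (x : Base ρ Δ) : ρ.ToType := x.1.time (x.2 κ)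

theorem fn_clock (κ : Δ) {x y : Base ρ Δ} (g : x ⟶ y) : g.1.fn (x.2 κ) = y.2 κ :=
  congrFun g.2 κ

theorem clockTime_le (κ : Δ) {x y : Base ρ Δ} (g : x ⟶ y) : clockTime κ y ≤ clockTime κ x := by
  have h := g.1.time_le (x.2 κ)
  rwa [fn_clock] at h

/-- The object `(E, ϑ[f(κ) ↦ α], f)`. -/
def delay (κ : Δ) (x : Base ρ Δ) (α : ρ.ToType) : Base ρ Δ :=
  ⟨⟨x.1.clocks, Function.update x.1.time (x.2 κ) α⟩, x.2⟩

theorem update_le {s t : TimeObj ρ} (g : s ⟶ t) {a : s.clocks} {b : t.clocks} (hab : g.fn a = b)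
    {α β : ρ.ToType} (h : β ≤ α) (hβ : β ≤ t.time b) (m : s.clocks) :
    Function.update t.time b β (g.fn m) ≤ Function.update s.time a α m := by
  by_cases hm : m = a
  · rw [hm, hab, Function.update_self, Function.update_self]
    exact h
  · rw [Function.update_of_ne hm]
    by_cases hg : g.fn m = b
    · rw [hg, Function.update_self]
      exact hβ.trans (hg ▸ g.time_le m)
    · rw [Function.update_of_ne hg]
      exact g.time_le m

/-- The morphism between delayed objects with the same underlying map as `g`. -/
def delayMap (κ : Δ) {x y : Base ρ Δ} (g : x ⟶ y) {α β : ρ.ToType} (h : β ≤ α)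
    (hβ : β ≤ clockTime κ y) : delay κ x α ⟶ delay κ y β :=
  ⟨⟨g.1.fn, update_le g.1 (fn_clock κ g) h hβ⟩, g.2⟩

/-- The morphism from `(E, ϑ, f)` to `(E, ϑ[f(κ) ↦ α], f)` for `α ≤ ϑ(f(κ))`, carried by the
identity. -/
def toDelay (κ : Δ) (x : Base ρ Δ) {α : ρ.ToType} (h : α ≤ clockTime κ x) : x ⟶ delay κ x α :=
  ⟨⟨id, fun m => (update_le (𝟙 x.1) rfl h h m).trans_eq
    (congrFun (Function.update_eq_self (x.2 κ) x.1.time) m)⟩, rfl⟩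

/-- The modality `▷^κ` on `GR ρ Δ`:
`(▷^κ X)(E, ϑ, f) = lim_{α < ϑ(f(κ))} X(E, ϑ[f(κ) ↦ α], f)`. -/
def later (κ : Δ) (X : GR ρ Δ) : GR ρ Δ where
  obj x := {s : ∀ α, α < clockTime κ x → X.obj (delay κ x α) //
    ∀ (α β : ρ.ToType) (hα : α < clockTime κ x) (hβ : β < clockTime κ x) (h : β ≤ α),
      X.map (delayMap κ (𝟙 x) h hβ.le) (s α hα) = s β hβ}
  map {x y} g := ↾(fun s => ⟨fun α hα =>
      X.map (delayMap κ g le_rfl hα.le) (s.1 α (hα.trans_le (clockTime_le κ g))),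
    fun α β hα hβ h => by
      dsimp only
      rw [← s.2 α β (hα.trans_le (clockTime_le κ g)) (hβ.trans_le (clockTime_le κ g)) h,
        ← Functor.map_comp_apply, ← Functor.map_comp_apply]
      rfl⟩)
  map_id x := by
    refine TypeCat.homEquiv.injective (funext fun s => Subtype.ext ?_)
    funext α hα
    exact s.2 α α hα hα le_rfl
  map_comp {x y z} g k := by
    refine TypeCat.homEquiv.injective (funext fun s => Subtype.ext ?_)
    funext α hα
    change X.map _ _ = X.map _ (X.map _ _)
    rw [← Functor.map_comp_apply]
    rfl

/-- The canonical map `X ⟶ ▷^κ X`. -/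
def next (κ : Δ) (X : GR ρ Δ) : X ⟶ later κ X where
  app x := ↾(fun a => ⟨fun α hα => X.map (toDelay κ x hα.le) a, fun α β hα hβ h => by
    rw [← Functor.map_comp_apply]
    rfl⟩)
  naturality {x y} g := by
    refine TypeCat.homEquiv.injective (funext fun a => Subtype.ext ?_)
    funext α hα
    change X.map _ (X.map _ _) = X.map _ (X.map _ _)
    rw [← Functor.map_comp_apply, ← Functor.map_comp_apply]
    rfl

/-- The morphism of elements of `Γ` induced at `α` by a morphism of elements of `▷^κ Γ`. -/
def laterTyMap (κ : Δ) {Γ : GR ρ Δ} {p q : (later κ Γ).Elements} (g : p ⟶ q) (α : ρ.ToType)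
    (hα : α < clockTime κ q.1) :
    Γ.elementsMk (delay κ p.1 α) (p.2.1 α (hα.trans_le (clockTime_le κ g.1))) ⟶
      Γ.elementsMk (delay κ q.1 α) (q.2.1 α hα) :=
  ⟨delayMap κ g.1 le_rfl hα.le, congrFun (congrFun (congrArg Subtype.val g.2) α) hα⟩

/-- The modality `▷^κ` on dependent types, taking a type over `Γ` to a type over `▷^κ Γ`:
`(▷^κ A)(E, ϑ, f, (γ_α)) = lim_{α < ϑ(f(κ))} A(E, ϑ[f(κ) ↦ α], f, γ_α)`. -/
def laterTy (κ : Δ) {Γ : GR ρ Δ} (A : Ty Γ) : Ty (later κ Γ) where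
  obj p := {s : ∀ (α : ρ.ToType) (hα : α < clockTime κ p.1),
      A.obj ⟨delay κ p.1 α, p.2.1 α hα⟩ //
    ∀ (α β : ρ.ToType) (hα : α < clockTime κ p.1) (hβ : β < clockTime κ p.1) (h : β ≤ α),
      A.map (⟨delayMap κ (𝟙 p.1) h hβ.le, p.2.2 α β hα hβ h⟩ :
        Γ.elementsMk (delay κ p.1 α) (p.2.1 α hα) ⟶ Γ.elementsMk (delay κ p.1 β) (p.2.1 β hβ))
        (s α hα) = s β hβ}
  map {p q} g := ↾(fun s => ⟨fun α hα =>
      A.map (laterTyMap κ g α hα)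
        (s.1 α (hα.trans_le (clockTime_le κ g.1))),
    fun α β hα hβ h => by
      dsimp only
      rw [← s.2 α β (hα.trans_le (clockTime_le κ g.1)) (hβ.trans_le (clockTime_le κ g.1)) h,
        ← Functor.map_comp_apply, ← Functor.map_comp_apply]
      rfl⟩)
  map_id p := by
    refine TypeCat.homEquiv.injective (funext fun s => Subtype.ext ?_)
    funext α hα
    exact s.2 α α hα hα le_rfl
  map_comp {p q r} g k := by
    refine TypeCat.homEquiv.injective (funext fun s => Subtype.ext ?_)
    funext α hα
    change A.map _ _ = A.map _ (A.map _ _)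
    rw [← Functor.map_comp_apply]
    rfl

variable [DecidableEq V]

/-- The projection `Clk^(Δ,κ) ⟶ Clk^Δ`. -/
def clkProj (ρ : Ordinal.{u}) (Δ : Finset V) (κ : V) : ClkPow ρ (insert κ Δ) ⟶ ClkPow ρ Δ where
  app t := ↾(fun f d => f ⟨d.1, Finset.mem_insert_of_mem d.2⟩)

/-- Weakening by a clock variable `κ`: the presheaf `(E, ϑ, f) ↦ Γ(E, ϑ, f|Δ)`, that is,
`Γ × Clk` regarded as an object over `Clk^(Δ,κ)`. -/
def weaken (κ : V) (Γ : GR ρ Δ) : GR ρ (insert κ Δ) :=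
  CategoryOfElements.map (clkProj ρ Δ κ) ⋙ Γ

/-- The projection from the elements of `Γ × Clk` to those of `Γ`. -/
def weakenProj (κ : V) (Γ : GR ρ Δ) : (weaken κ Γ).Elements ⥤ Γ.Elements where
  obj r := ⟨(CategoryOfElements.map (clkProj ρ Δ κ)).obj r.1, r.2⟩
  map g := ⟨(CategoryOfElements.map (clkProj ρ Δ κ)).map g.1, g.2⟩

/-- Universal quantification over the clock `κ`: the dependent product of a type over `Γ × Clk`
along the projection to `Γ`. -/
def forallClk (κ : V) {Γ : GR ρ Δ} (A : Ty (weaken κ Γ)) : Ty Γ :=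
  piAlong (weakenProj κ Γ) A

end Clocks

end ClockModel

open ClockModel

/-! Clocks that no variable of `Δ` names are invisible to invariant data, so the truth of a
predicate should depend only on the profile of an object: which variables name the same clock, and
the times of the named clocks. `ProfileLE` preorders objects by profile. The universe assigns to `x`
the upward closed sets of objects above `x` in this preorder, and such a set is true at `x` if it
contains `x`. Being built from profiles, it is invariant.

Two constructions link profiles with morphisms. The core of an object consists of its named clocks;
a morphism from a core to `y` is unique, and exists as soon as the profiles are comparable. If `z`
lies above `x`, their amalgam is an object `q` under both, with the profile of `z`, that maps to
every object to which both `x` and `z` map. Thus every profile above `x` is realised by a morphism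
out of `x`, and so a code is determined by its predicate over any `Γ`.

For existence, `exists_code` asks only that, for fixed `γ`, truth at `(y, g·γ)` be monotone in the
profile of `y`. For a predicate on an invariant object this follows by descending to cores. For the
closure properties, membership in a code is monotone between any two elements with a common source
(`mem_app_of_profileLE`). Under a quantifier the common source is an amalgam; an element of a family
over an invariant object is first brought down to a core. -/

namespace ClockModel

/-! ### Embeddings and amalgams of time objects. -/

section TimeObjects

variable {ρ : Ordinal.{u}}

/-- The time object on a finite type of clocks, up to renaming the clocks. -/
theorem exists_timeObj (T : Type*) [Finite T] (τ : T → ρ.ToType) :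
    ∃ (t : TimeObj ρ) (e : t.clocks ≃ T), ∀ n, t.time n = τ (e n) := by
  obtain ⟨n, ⟨e⟩⟩ := Finite.exists_equiv_fin T
  let e' : Finset.range n ≃ T :=
    (Equiv.subtypeEquivRight (fun _ => Finset.mem_range)).trans
      (Fin.equivSubtype.symm.trans e.symm)
  exact ⟨⟨Finset.range n, τ ∘ e'⟩, e', fun _ => rfl⟩

/-- An embedding of time objects: an injective map of clocks that preserves the times. -/
def IsEmbedding {s t : TimeObj ρ} (σ : s ⟶ t) : Prop :=
  Function.Injective σ.fn ∧ ∀ n, t.time (σ.fn n) = s.time n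

/-- The closure of the clock introductions under composition with isomorphisms. -/
inductive IsIteratedIntro : ∀ {s t : TimeObj ρ}, (s ⟶ t) → Prop
  | iso {s t : TimeObj ρ} (σ : s ≅ t) : IsIteratedIntro σ.hom
  | comp_intro {s t r : TimeObj ρ} (σ : s ⟶ t) (τ : t ⟶ r) :
      IsIteratedIntro σ → IsClockIntro τ → IsIteratedIntro (σ ≫ τ)

theorem IsClockIntro.isEmbedding {s t : TimeObj ρ} {σ : s ⟶ t} (h : IsClockIntro σ) :
    IsEmbedding σ := by
  obtain ⟨κ, _, _, h⟩ := h
  exact ⟨fun a b e => Subtype.ext (by rw [← (h a).1, e, (h b).1]), fun n => (h n).2⟩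

/-- Induction on the number of clocks of the target: an embedding that is not surjective misses some
clock and factors through the introduction of that clock. This extends invariance from single
introductions to all embeddings. -/
theorem IsEmbedding.isIteratedIntro {s t : TimeObj ρ} {σ : s ⟶ t} (h : IsEmbedding σ) :
    IsIteratedIntro σ := by
  induction hn : t.clocks.card generalizing t with
  | zero =>
    have ht : ∀ y : t.clocks, False := fun y => by
      have := Finset.card_eq_zero.1 hn
      exact absurd y.2 (by simp [this])
    exact .iso ⟨σ, ⟨fun y => (ht y).elim, fun y => (ht y).elim⟩,
      TimeHom.ext (funext fun n => (ht (σ.fn n)).elim),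
      TimeHom.ext (funext fun n => (ht n).elim)⟩
  | succ n ih =>
    by_cases hs : Function.Surjective σ.fn
    · let e := Equiv.ofBijective σ.fn ⟨h.1, hs⟩
      have he : ∀ y, σ.fn (e.symm y) = y := e.apply_symm_apply
      exact .iso ⟨σ, ⟨e.symm, fun y => by rw [← h.2, he]⟩,
        TimeHom.ext (funext fun n => e.symm_apply_apply n),
        TimeHom.ext (funext fun n => he n)⟩
    · obtain ⟨⟨κ, hκ⟩, hy⟩ := not_forall.1 hs
      let t' : TimeObj ρ :=
        ⟨t.clocks.erase κ, fun m => t.time ⟨m, Finset.mem_of_mem_erase m.2⟩⟩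
      have hne : ∀ m, (σ.fn m : ℕ) ≠ κ := fun m hm => hy ⟨m, Subtype.ext hm⟩
      let σ' : s ⟶ t' :=
        ⟨fun m => ⟨σ.fn m, Finset.mem_erase.2 ⟨hne m, (σ.fn m).2⟩⟩, σ.time_le⟩
      let τ : t' ⟶ t := ⟨fun m => ⟨m, Finset.mem_of_mem_erase m.2⟩, fun _ => le_rfl⟩
      have hσ' : IsEmbedding σ' :=
        ⟨fun a b e => h.1 (Subtype.ext (congrArg (fun m : t'.clocks => (m : ℕ)) e)), h.2⟩
      have hτ : IsClockIntro τ := ⟨κ, Finset.notMem_erase _ _,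
        (Finset.insert_erase hκ).symm, fun _ => ⟨rfl, rfl⟩⟩
      refine .comp_intro σ' τ (ih hσ' ?_) hτ
      change (t.clocks.erase κ).card = n
      rw [Finset.card_erase_of_mem hκ, hn, Nat.add_sub_cancel]

/-- Amalgamation of `z` with `x` along a set of clock variables, in case there is a map from the
clocks of `x` named by a variable to those of `z`. -/
theorem exists_amalgam {x z : TimeObj ρ} {ι : Type*} (f : ι → x.clocks) (f' : ι → z.clocks)
    (hker : ∀ a b, f a = f b → f' a = f' b) (hle : ∀ a, z.time (f' a) ≤ x.time (f a)) :
    ∃ (q : TimeObj ρ) (i : z ⟶ q) (j : x ⟶ q), IsEmbedding i ∧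
      (∀ a, j.fn (f a) = i.fn (f' a)) ∧
      ∀ (v : TimeObj ρ) (t : z ⟶ v) (k : x ⟶ v), (∀ a, k.fn (f a) = t.fn (f' a)) →
        ∃ r : q ⟶ v, i ≫ r = t ∧ j ≫ r = k := by
  classical
  -- A named clock of `x` is identified with its counterpart in `z` and takes the time it has there,
  -- the lower one by `hle`; the unnamed clocks of `x` are added freely.
  obtain ⟨q, e, he⟩ := exists_timeObj (z.clocks ⊕ {n : x.clocks // n ∉ Set.range f})
    (Sum.elim z.time fun n => x.time n.1)
  have he' : ∀ m, q.time (e.symm m) = Sum.elim z.time (fun n => x.time n.1) m := fun m => by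
    rw [he, e.apply_symm_apply]
  let i : z ⟶ q := ⟨fun n => e.symm (.inl n), fun n => (he' _).le⟩
  -- By `hker` it does not matter which name of a named clock is chosen.
  let m (n : x.clocks) : z.clocks ⊕ {n : x.clocks // n ∉ Set.range f} :=
    if h : n ∈ Set.range f then .inl (f' h.choose) else .inr ⟨n, h⟩
  have hm : ∀ a, m (f a) = .inl (f' a) := fun a => by
    have h : f a ∈ Set.range f := ⟨a, rfl⟩
    exact (dif_pos h).trans (congrArg _ (hker _ _ h.choose_spec))
  have hm' : ∀ n (h : n ∉ Set.range f), m n = .inr ⟨n, h⟩ := fun n h => dif_neg h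
  let j : x ⟶ q := ⟨fun n => e.symm (m n), fun n => by
    rw [he']
    by_cases h : n ∈ Set.range f
    · obtain ⟨a, rfl⟩ := h
      rw [hm]
      exact hle a
    · rw [hm' n h]
      exact le_rfl⟩
  refine ⟨q, i, j, ⟨fun a b h => Sum.inl_injective (e.symm.injective h), fun n => he' _⟩,
    fun a => congrArg e.symm (hm a), fun v t k hk => ?_⟩
  let r : q ⟶ v := ⟨fun n => Sum.elim t.fn (fun n => k.fn n.1) (e n), fun n => by
    rw [he]
    rcases e n with a | a
    · exact t.time_le a
    · exact k.time_le a.1⟩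
  refine ⟨r, TimeHom.ext (funext fun n => ?_), TimeHom.ext (funext fun n => ?_)⟩
  · change Sum.elim t.fn _ (e (e.symm _)) = _
    rw [e.apply_symm_apply]
    rfl
  · change Sum.elim t.fn _ (e (e.symm (m n))) = _
    rw [e.apply_symm_apply]
    by_cases h : n ∈ Set.range f
    · obtain ⟨a, rfl⟩ := h
      rw [hm]
      exact (hk a).symm
    · rw [hm' n h]
      rfl

end TimeObjects

/-! ### The profile preorder, cores and amalgams. -/

section Profiles

variable {ρ : Ordinal.{u}} {V : Type u} {Δ : Finset V}

/-- The clocks named by the clock variables at `x` map to those named at `y`. -/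
def ProfileLE (x y : Base ρ Δ) : Prop :=
  (∀ a b, x.2 a = x.2 b → y.2 a = y.2 b) ∧ ∀ a, clockTime a y ≤ clockTime a x

theorem ProfileLE.refl (x : Base ρ Δ) : ProfileLE x x := ⟨fun _ _ => id, fun _ => le_rfl⟩

theorem ProfileLE.trans {x y z : Base ρ Δ} (h : ProfileLE x y) (k : ProfileLE y z) :
    ProfileLE x z :=
  ⟨fun a b e => k.1 a b (h.1 a b e), fun a => (k.2 a).trans (h.2 a)⟩

theorem ProfileLE.of_hom {x y : Base ρ Δ} (g : x ⟶ y) : ProfileLE x y :=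
  ⟨fun a b e => by rw [← fn_clock a g, ← fn_clock b g, e], fun a => clockTime_le a g⟩

/-- With `ProfileLE.of_hom` this shows that both ends of an embedding have the same profile, so that
upward closed sets cannot tell them apart. -/
theorem IsEmbedding.profileLE {x y : Base ρ Δ} {g : x ⟶ y} (h : IsEmbedding g.1) :
    ProfileLE y x := by
  refine ⟨fun a b e => h.1 ?_, fun a => ?_⟩
  · rw [fn_clock, fn_clock, e]
  · have := h.2 (x.2 a)
    rw [fn_clock] at this
    exact this.ge

theorem ProfileLE.delay {x y : Base ρ Δ} (h : ProfileLE x y) (κ : Δ) {α : ρ.ToType}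
    (hα : α ≤ clockTime κ y) :
    ProfileLE (delay κ x α) (delay κ y α) := by
  refine ⟨h.1, fun a => ?_⟩
  change Function.update y.1.time (y.2 κ) α (y.2 a) ≤ Function.update x.1.time (x.2 κ) α (x.2 a)
  by_cases hx : x.2 a = x.2 κ
  · rw [hx, h.1 _ _ hx, Function.update_self, Function.update_self]
  · rw [Function.update_of_ne hx]
    -- `y` may identify clocks that `x` keeps apart. Then `α` is compared with an unchanged time of
    -- `x`, and `hα` is needed.
    by_cases hy : y.2 a = y.2 κ
    · rw [hy, Function.update_self]
      refine hα.trans (le_of_eq_of_le ?_ (h.2 a))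
      exact congrArg y.1.time hy.symm
    · rw [Function.update_of_ne hy]
      exact h.2 a

/-- The part of `x` on the clocks named by a clock variable. -/
theorem exists_core (x : Base ρ Δ) :
    ∃ (c : Base ρ Δ) (i : c ⟶ x), IsEmbedding i.1 ∧ ∀ n : c.1.clocks, ∃ a, c.2 a = n := by
  let f : Δ → x.1.clocks := x.2
  obtain ⟨t, e, he⟩ := exists_timeObj (Set.range f) (fun n => x.1.time n.1)
  refine ⟨⟨t, fun a => e.symm ⟨f a, a, rfl⟩⟩, ⟨⟨fun n => (e n).1, fun n => (he n).ge⟩, ?_⟩,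
    ⟨fun a b h => e.injective (Subtype.ext h), fun n => (he n).symm⟩, fun n => ?_⟩
  · refine funext fun a => ?_
    change (e (e.symm _)).1 = _
    rw [e.apply_symm_apply]
  · obtain ⟨a, ha⟩ := (e n).2
    exact ⟨a, e.injective (Subtype.ext (by simpa using ha))⟩

/-- Morphisms preserve the naming, so they are determined on named clocks. -/
theorem hom_ext_of_surjective {c y : Base ρ Δ} (hc : ∀ n : c.1.clocks, ∃ a, c.2 a = n)
    (g h : c ⟶ y) : g = h := by
  refine Subtype.ext (TimeHom.ext (funext fun n => ?_))
  obtain ⟨a, rfl⟩ := hc n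
  rw [fn_clock, fn_clock]

theorem ProfileLE.nonempty_hom {c y : Base ρ Δ} (h : ProfileLE c y)
    (hc : ∀ n : c.1.clocks, ∃ a, c.2 a = n) : Nonempty (c ⟶ y) := by
  choose a ha using hc
  refine ⟨⟨⟨fun n => y.2 (a n), fun n => ?_⟩, funext fun b => h.1 _ _ (ha _)⟩⟩
  exact (h.2 (a n)).trans_eq (congrArg c.1.time (ha n))

theorem ProfileLE.exists_amalgam {x z : Base ρ Δ} (h : ProfileLE x z) :
    ∃ (q : Base ρ Δ) (i : z ⟶ q) (j : x ⟶ q), IsEmbedding i.1 ∧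
      ∀ (v : Base ρ Δ) (t : z ⟶ v) (k : x ⟶ v), ∃ r : q ⟶ v, i ≫ r = t ∧ j ≫ r = k := by
  obtain ⟨q, i, j, hi, hij, hq⟩ := ClockModel.exists_amalgam (x := x.1) (z := z.1) x.2 z.2 h.1 h.2
  refine ⟨⟨q, fun a => i.fn (z.2 a)⟩, ⟨i, rfl⟩, ⟨j, funext hij⟩, hi, fun v t k => ?_⟩
  obtain ⟨r, hr, hr'⟩ := hq v.1 t.1 k.1 (fun a => (fn_clock a k).trans (fn_clock a t).symm)
  refine ⟨⟨r, funext fun a => ?_⟩, Subtype.ext hr, Subtype.ext hr'⟩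
  exact (congrFun (congrArg TimeHom.fn hr) (z.2 a)).trans (fn_clock a t)

/-- Gluing is along `Δ` only; the clock named `κ` is supplied by `z`. -/
theorem ProfileLE.exists_amalgam_clkProj [DecidableEq V] {κ : V} {x : Base ρ Δ}
    {z : Base ρ (insert κ Δ)}
    (h : ProfileLE x ((CategoryOfElements.map (clkProj ρ Δ κ)).obj z)) :
    ∃ (q : Base ρ (insert κ Δ)) (i : z ⟶ q)
      (j : x ⟶ (CategoryOfElements.map (clkProj ρ Δ κ)).obj q), IsEmbedding i.1 ∧
      ∀ (v : Base ρ (insert κ Δ)) (t : z ⟶ v)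
        (k : x ⟶ (CategoryOfElements.map (clkProj ρ Δ κ)).obj v),
        ∃ r : q ⟶ v, i ≫ r = t ∧ j ≫ (CategoryOfElements.map (clkProj ρ Δ κ)).map r = k := by
  obtain ⟨q, i, j, hi, hij, hq⟩ := ClockModel.exists_amalgam (x := x.1) (z := z.1) x.2
    (fun a : Δ => z.2 ⟨a, Finset.mem_insert_of_mem a.2⟩) h.1 h.2
  refine ⟨⟨q, fun a => i.fn (z.2 a)⟩, ⟨i, rfl⟩, ⟨j, funext hij⟩, hi, fun v t k => ?_⟩
  obtain ⟨r, hr, hr'⟩ := hq v.1 t.1 k.1 (fun a => (fn_clock a k).trans (fn_clock _ t).symm)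
  refine ⟨⟨r, funext fun a => ?_⟩, Subtype.ext hr, Subtype.ext hr'⟩
  exact (congrFun (congrArg TimeHom.fn hr) (z.2 a)).trans (fn_clock a t)

end Profiles

/-! ### Invariance along embeddings. -/

section Invariance

variable {ρ : Ordinal.{u}} {V : Type u} {Δ : Finset V}

theorem bijective_map_iso {D : Type*} [Category D] (X : D ⥤ Type u) {a b : D} (g : a ⟶ b)
    [IsIso g] : Function.Bijective (X.map g) :=
  (isIso_iff_bijective _).1 inferInstance

/-- The namings `f` and `f'` are kept apart from the time objects so that the induction can factor
the morphism through the naming pushed forward along `σ`. -/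
theorem bijective_map_of_isIteratedIntro {X : GR ρ Δ} (hX : IsClockInvariant X) {s t : TimeObj ρ}
    {σ : s ⟶ t} (h : IsIteratedIntro σ) {f : (ClkPow ρ Δ).obj s} {f' : (ClkPow ρ Δ).obj t}
    (hσ : (ClkPow ρ Δ).map σ f = f') :
    Function.Bijective
      (X.map (⟨σ, hσ⟩ : (ClkPow ρ Δ).elementsMk s f ⟶ (ClkPow ρ Δ).elementsMk t f')) := by
  induction h with
  | iso σ =>
    let g : (ClkPow ρ Δ).elementsMk _ f ⟶ (ClkPow ρ Δ).elementsMk _ f' := ⟨σ.hom, hσ⟩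
    have : IsIso ((CategoryOfElements.π (ClkPow ρ Δ)).map g) := inferInstanceAs (IsIso σ.hom)
    have : IsIso g := isIso_of_reflects_iso _ (CategoryOfElements.π (ClkPow ρ Δ))
    exact bijective_map_iso X g
  | comp_intro σ τ h hτ ih =>
    let g : (ClkPow ρ Δ).elementsMk _ f ⟶ (ClkPow ρ Δ).elementsMk _ ((ClkPow ρ Δ).map σ f) :=
      ⟨σ, rfl⟩
    let k : (ClkPow ρ Δ).elementsMk _ ((ClkPow ρ Δ).map σ f) ⟶ (ClkPow ρ Δ).elementsMk _ f' :=
      ⟨τ, (Functor.map_comp_apply _ _ _ _).symm.trans hσ⟩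
    have hgk := (hX k hτ).comp (ih rfl : Function.Bijective (X.map g))
    convert hgk using 1
    exact funext fun a => X.map_comp_apply g k a

theorem IsClockInvariant.bijective_map {X : GR ρ Δ} (hX : IsClockInvariant X) {x y : Base ρ Δ}
    (g : x ⟶ y) (hg : IsEmbedding g.1) : Function.Bijective (X.map g) :=
  bijective_map_of_isIteratedIntro hX hg.isIteratedIntro g.2

theorem bijective_tyMap_of_isIteratedIntro {Γ : GR ρ Δ} {A : Ty Γ} (hA : IsFamily A)
    {s t : TimeObj ρ} {σ : s ⟶ t} (h : IsIteratedIntro σ) {f : (ClkPow ρ Δ).obj s}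
    {f' : (ClkPow ρ Δ).obj t} (hσ : (ClkPow ρ Δ).map σ f = f')
    {γ : Γ.obj ((ClkPow ρ Δ).elementsMk s f)} {δ : Γ.obj ((ClkPow ρ Δ).elementsMk t f')}
    (hδ : Γ.map (⟨σ, hσ⟩ : (ClkPow ρ Δ).elementsMk s f ⟶ (ClkPow ρ Δ).elementsMk t f') γ = δ) :
    Function.Bijective (A.map (⟨⟨σ, hσ⟩, hδ⟩ : Γ.elementsMk _ γ ⟶ Γ.elementsMk _ δ)) := by
  induction h with
  | iso σ =>
    let g : Γ.elementsMk _ γ ⟶ Γ.elementsMk _ δ := ⟨⟨σ.hom, hσ⟩, hδ⟩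
    have : IsIso ((CategoryOfElements.π Γ ⋙ CategoryOfElements.π (ClkPow ρ Δ)).map g) :=
      inferInstanceAs (IsIso σ.hom)
    have : IsIso g := isIso_of_reflects_iso _ (CategoryOfElements.π Γ ⋙
      CategoryOfElements.π (ClkPow ρ Δ))
    exact bijective_map_iso A g
  | comp_intro σ τ h hτ ih =>
    let g₀ : (ClkPow ρ Δ).elementsMk _ f ⟶ (ClkPow ρ Δ).elementsMk _ ((ClkPow ρ Δ).map σ f) :=
      ⟨σ, rfl⟩
    let k₀ : (ClkPow ρ Δ).elementsMk _ ((ClkPow ρ Δ).map σ f) ⟶ (ClkPow ρ Δ).elementsMk _ f' :=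
      ⟨τ, (Functor.map_comp_apply _ _ _ _).symm.trans hσ⟩
    let g : Γ.elementsMk _ γ ⟶ Γ.elementsMk _ (Γ.map g₀ γ) := ⟨g₀, rfl⟩
    let k : Γ.elementsMk _ (Γ.map g₀ γ) ⟶ Γ.elementsMk _ δ :=
      ⟨k₀, (Functor.map_comp_apply _ _ _ _).symm.trans hδ⟩
    have hgk := (hA k hτ).comp (ih rfl rfl : Function.Bijective (A.map g))
    convert hgk using 1
    exact funext fun a => A.map_comp_apply g k a

theorem IsFamily.bijective_map {Γ : GR ρ Δ} {A : Ty Γ} (hA : IsFamily A) {p q : Γ.Elements}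
    (g : p ⟶ q) (hg : IsEmbedding g.1.1) : Function.Bijective (A.map g) :=
  bijective_tyMap_of_isIteratedIntro hA hg.isIteratedIntro g.1.2 g.2

end Invariance

/-! ### Types with subsingleton fibres. -/

section Predicates

variable {D : Type u} [Category.{0} D]

theorem nonempty_iso_of_subsingleton {A B : D ⥤ Type u} (hA : ∀ p, Subsingleton (A.obj p))
    (hB : ∀ p, Subsingleton (B.obj p)) (h : ∀ p, Nonempty (A.obj p) ↔ Nonempty (B.obj p)) :
    Nonempty (A ≅ B) := by
  refine ⟨NatIso.ofComponents (fun p => Equiv.toIso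
    ⟨fun a => ((h p).1 ⟨a⟩).some, fun b => ((h p).2 ⟨b⟩).some,
      fun _ => Subsingleton.elim _ _, fun _ => Subsingleton.elim _ _⟩) fun {p q} g => ?_⟩
  exact TypeCat.homEquiv.injective (funext fun a => Subsingleton.elim _ _)

theorem nonempty_iff_of_iso {A B : D ⥤ Type u} (e : A ≅ B) (p : D) :
    Nonempty (A.obj p) ↔ Nonempty (B.obj p) :=
  ⟨fun ⟨a⟩ => ⟨e.hom.app p a⟩, fun ⟨b⟩ => ⟨e.inv.app p b⟩⟩

theorem subsingleton_piAlong {E : Type u} [Category.{0} E] (F : D ⥤ E) {B : D ⥤ Type u}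
    (hB : ∀ r, Subsingleton (B.obj r)) (p : E) : Subsingleton ((piAlong F B).obj p) :=
  ⟨fun _ _ => Subtype.ext (funext fun _ => funext fun _ => Subsingleton.elim _ _)⟩

theorem nonempty_piAlong {E : Type u} [Category.{0} E] (F : D ⥤ E) {B : D ⥤ Type u}
    (hB : ∀ r, Subsingleton (B.obj r)) (p : E) :
    Nonempty ((piAlong F B).obj p) ↔ ∀ r, (p ⟶ F.obj r) → Nonempty (B.obj r) :=
  ⟨fun ⟨s⟩ r g => ⟨s.1 r g⟩, fun h => ⟨⟨fun r g => (h r g).some,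
    fun _ _ _ _ => Subsingleton.elim _ _⟩⟩⟩

end Predicates

/-! ### The universe of predicates and its codes. -/

section Universe

variable {ρ : Ordinal.{u}} {V : Type u}

/-- The universe of predicates: the elements at `x` are the sets of objects above `x`, in the
preorder given by the clocks named by a clock variable, that are closed upwards. -/
def propObj (ρ : Ordinal.{u}) (Δ : Finset V) : GR ρ Δ where
  obj x := {S : Set (Base ρ Δ) //
    (∀ w ∈ S, ProfileLE x w) ∧ ∀ w w', w ∈ S → ProfileLE w w' → w' ∈ S}
  map {x y} g := ↾(fun S => ⟨{w | w ∈ S.1 ∧ ProfileLE y w}, fun _ h => h.2,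
    fun _ _ h k => ⟨S.2.2 _ _ h.1 k, h.2.trans k⟩⟩)
  map_id x := by
    refine TypeCat.homEquiv.injective (funext fun S => Subtype.ext (Set.ext fun w => ?_))
    exact ⟨fun h => h.1, fun h => ⟨h, S.2.1 w h⟩⟩
  map_comp {x y z} g k := by
    refine TypeCat.homEquiv.injective (funext fun S => Subtype.ext (Set.ext fun w => ?_))
    exact ⟨fun h => ⟨⟨h.1, (ProfileLE.of_hom k).trans h.2⟩, h.2⟩, fun h => ⟨h.1.1, h.2⟩⟩

/-- The decoding of the universe of predicates: a set of objects is true at `x` if it contains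
`x`. -/
def propEl (ρ : Ordinal.{u}) (Δ : Finset V) : Ty (propObj ρ Δ) where
  obj p := {_s : PUnit.{u + 1} // p.1 ∈ p.2.1}
  map {p q} g := ↾(fun s => ⟨s.1, by
    rw [← g.2]
    exact ⟨p.2.2.2 _ _ s.2 (.of_hom g.1), .refl _⟩⟩)

variable {Δ : Finset V}

theorem subsingleton_propEl (p : (propObj ρ Δ).Elements) :
    Subsingleton ((propEl ρ Δ).obj p) :=
  ⟨fun _ _ => Subtype.ext rfl⟩

theorem nonempty_propEl (p : (propObj ρ Δ).Elements) :
    Nonempty ((propEl ρ Δ).obj p) ↔ p.1 ∈ p.2.1 :=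
  ⟨fun ⟨s⟩ => s.2, fun h => ⟨⟨⟨⟩, h⟩⟩⟩

theorem IsClockIntro.profileLE {x y : Base ρ Δ} {g : x ⟶ y} (h : IsClockIntro g.1) :
    ProfileLE y x :=
  h.isEmbedding.profileLE

theorem isClockInvariant_propObj : IsClockInvariant (propObj ρ Δ) := by
  intro x y g hg
  have hyx : ProfileLE y x := IsClockIntro.profileLE hg
  refine ⟨fun S T h => Subtype.ext (Set.ext fun w => ?_), fun T => ?_⟩
  · have hw : w ∈ S.1 ∧ ProfileLE y w ↔ w ∈ T.1 ∧ ProfileLE y w :=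
      Set.ext_iff.1 (congrArg Subtype.val h) w
    exact ⟨fun h => (hw.1 ⟨h, hyx.trans (S.2.1 w h)⟩).1,
      fun h => (hw.2 ⟨h, hyx.trans (T.2.1 w h)⟩).1⟩
  · exact ⟨⟨T.1, fun w h => (ProfileLE.of_hom g).trans (T.2.1 w h), T.2.2⟩,
      Subtype.ext (Set.ext fun w => ⟨fun h => h.1, fun h => ⟨h, T.2.1 w h⟩⟩)⟩

theorem isPredicate_propEl : IsPredicate (propEl ρ Δ) := by
  refine ⟨fun p q g hg => ?_, subsingleton_propEl⟩
  have := subsingleton_propEl p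
  have := subsingleton_propEl q
  refine ⟨fun _ _ _ => Subsingleton.elim _ _, fun b => ?_⟩
  have hb : q.1 ∈ q.2.1 := b.2
  rw [← g.2] at hb
  exact ⟨⟨⟨⟩, p.2.2.2 _ _ hb.1 (IsClockIntro.profileLE hg)⟩, Subsingleton.elim _ _⟩

theorem mem_app_iff {Γ : GR ρ Δ} (c : Γ ⟶ propObj ρ Δ) {x y : Base ρ Δ} (g : x ⟶ y)
    {γ : Γ.obj x} {δ : Γ.obj y} (h : Γ.map g γ = δ) (w : Base ρ Δ) :
    w ∈ (c.app y δ).1 ↔ w ∈ (c.app x γ).1 ∧ ProfileLE y w := by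
  subst h
  rw [NatTrans.naturality_apply]
  rfl

/-- Codes are determined by the predicates they encode. -/
theorem eq_of_reindex_iso {Γ : GR ρ Δ} {c d : Γ ⟶ propObj ρ Δ}
    (e : Nonempty (reindex c (propEl ρ Δ) ≅ reindex d (propEl ρ Δ))) : c = d := by
  obtain ⟨e⟩ := e
  have he (p : Γ.Elements) : p.1 ∈ (c.app p.1 p.2).1 ↔ p.1 ∈ (d.app p.1 p.2).1 :=
    (nonempty_propEl _).symm.trans ((nonempty_iff_of_iso e p).trans (nonempty_propEl _))
  refine NatTrans.ext (funext fun x => TypeCat.homEquiv.injective (funext fun γ =>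
    Subtype.ext (Set.ext fun w => ?_)))
  change w ∈ (c.app x γ).1 ↔ w ∈ (d.app x γ).1
  by_cases hw : ProfileLE x w
  · obtain ⟨q, i, j, hi, -⟩ := hw.exists_amalgam
    have hq (c : Γ ⟶ propObj ρ Δ) :
        w ∈ (c.app x γ).1 ↔ q ∈ (c.app q (Γ.map j γ)).1 :=
      ⟨fun h => (mem_app_iff c j rfl q).2 ⟨(c.app x γ).2.2 _ _ h (.of_hom i), .refl q⟩,
        fun h => (c.app x γ).2.2 _ _ ((mem_app_iff c j rfl q).1 h).1 hi.profileLE⟩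
    rw [hq, hq, he ⟨q, Γ.map j γ⟩]
  · exact ⟨fun h => (hw ((c.app x γ).2.1 w h)).elim, fun h => (hw ((d.app x γ).2.1 w h)).elim⟩

/-- A type with subsingleton fibres has a code if its truth at `(y, g·γ)` only depends on `γ` and
the clocks of `y` named by a clock variable. -/
theorem exists_code {Γ : GR ρ Δ} {A : Ty Γ} (hA : ∀ p, Subsingleton (A.obj p))
    (h : ∀ (x : Base ρ Δ) (γ : Γ.obj x) (y y' : Base ρ Δ) (g : x ⟶ y) (g' : x ⟶ y'),
      ProfileLE y y' → Nonempty (A.obj ⟨y, Γ.map g γ⟩) → Nonempty (A.obj ⟨y', Γ.map g' γ⟩)) :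
    ∃ c : Γ ⟶ propObj ρ Δ, Nonempty (A ≅ reindex c (propEl ρ Δ)) := by
  let S (x : Base ρ Δ) (γ : Γ.obj x) : (propObj ρ Δ).obj x :=
    ⟨{w | ∃ (y : Base ρ Δ) (g : x ⟶ y), ProfileLE y w ∧ Nonempty (A.obj ⟨y, Γ.map g γ⟩)},
      fun w ⟨y, g, hw, _⟩ => (ProfileLE.of_hom g).trans hw,
      fun w w' ⟨y, g, hw, ha⟩ hw' => ⟨y, g, hw.trans hw', ha⟩⟩
  let c : Γ ⟶ propObj ρ Δ :=
    { app := fun x => ↾(S x)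
      naturality := fun x x' k => by
        refine TypeCat.homEquiv.injective (funext fun γ => Subtype.ext (Set.ext fun w => ?_))
        constructor
        · rintro ⟨y, g, hw, ha⟩
          refine ⟨⟨y, k ≫ g, hw, ?_⟩, (ProfileLE.of_hom g).trans hw⟩
          rwa [Functor.map_comp_apply]
        · rintro ⟨⟨y, g, hw, ha⟩, hw'⟩
          -- The witness `y` need not receive a morphism from `x'`. The amalgam of `x'` with `w`
          -- does, and `h` carries truth from `y` to it.
          obtain ⟨q, i, j, hi, -⟩ := hw'.exists_amalgam
          refine ⟨q, j, hi.profileLE, ?_⟩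
          have := h x γ y q g (k ≫ j) (hw.trans (.of_hom i)) ha
          rwa [Functor.map_comp_apply] at this }
  refine ⟨c, nonempty_iso_of_subsingleton hA (fun _ => subsingleton_propEl _) fun p => ?_⟩
  refine Iff.trans ?_ (nonempty_propEl _).symm
  have hid : A.obj ⟨p.1, Γ.map (𝟙 p.1) p.2⟩ = A.obj p := by
    rw [Γ.map_id_apply]
    rfl
  constructor
  · intro ha
    exact ⟨p.1, 𝟙 _, .refl _, by rwa [hid]⟩
  · rintro ⟨y, g, hw, ha⟩
    rw [← hid]
    exact h p.1 p.2 y p.1 g (𝟙 _) hw ha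

/-- A predicate on an invariant object has a code. -/
theorem exists_code_of_isPredicate {Γ : GR ρ Δ} {A : Ty Γ} (hΓ : IsClockInvariant Γ)
    (hA : IsPredicate A) : ∃ c : Γ ⟶ propObj ρ Δ, Nonempty (A ≅ reindex c (propEl ρ Δ)) := by
  refine exists_code hA.2 fun x γ y y' g g' hy ⟨a⟩ => ?_
  -- `γ` comes from the core of `x`, where transport is unique. So `a` descends to the core `d` of
  -- `y` and can be pushed along `d ⟶ y'`.
  obtain ⟨c, i, hi, hc⟩ := exists_core x
  obtain ⟨δ, rfl⟩ := (hΓ.bijective_map i hi).2 γ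
  obtain ⟨d, k, hk, hd⟩ := exists_core y
  obtain ⟨l⟩ := (((ProfileLE.of_hom i).trans (ProfileLE.of_hom g)).trans
    hk.profileLE).nonempty_hom hc
  obtain ⟨m⟩ := ((ProfileLE.of_hom k).trans hy).nonempty_hom hd
  have e : Γ.map k (Γ.map l δ) = Γ.map g (Γ.map i δ) := by
    rw [← Functor.map_comp_apply, ← Functor.map_comp_apply, hom_ext_of_surjective hc (l ≫ k)]
  have e' : Γ.map m (Γ.map l δ) = Γ.map g' (Γ.map i δ) := by
    rw [← Functor.map_comp_apply, ← Functor.map_comp_apply, hom_ext_of_surjective hc (l ≫ m)]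
  obtain ⟨a', -⟩ := (hA.1.bijective_map
    (⟨k, e⟩ : Γ.elementsMk d (Γ.map l δ) ⟶ Γ.elementsMk y _) hk).2 a
  exact ⟨A.map (⟨m, e'⟩ : Γ.elementsMk d (Γ.map l δ) ⟶ Γ.elementsMk y' _) a'⟩

/-- By naturality, both memberships are tested in the one upward closed set attached to the common
source `γ`. -/
theorem mem_app_of_profileLE {Γ : GR ρ Δ} (c : Γ ⟶ propObj ρ Δ) {x y y' : Base ρ Δ}
    {g : x ⟶ y} {g' : x ⟶ y'} {γ : Γ.obj x} {δ : Γ.obj y} {δ' : Γ.obj y'} (hδ : Γ.map g γ = δ)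
    (hδ' : Γ.map g' γ = δ') {w w' : Base ρ Δ} (hw : w ∈ (c.app y δ).1) (h : ProfileLE w w')
    (hw' : ProfileLE y' w') : w' ∈ (c.app y' δ').1 :=
  (mem_app_iff c g' hδ' w').2
    ⟨(c.app x γ).2.2 _ _ ((mem_app_iff c g hδ w).1 hw).1 h, hw'⟩

/-! ### Closure under the logical operations. -/

theorem exists_code_conjTy {Γ : GR ρ Δ} {ι : Type} (b : ι → (Γ ⟶ propObj ρ Δ)) :
    ∃ c : Γ ⟶ propObj ρ Δ,
      Nonempty (conjTy (fun i => reindex (b i) (propEl ρ Δ)) ≅ reindex c (propEl ρ Δ)) := by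
  refine exists_code (fun p => ⟨fun s t => funext fun i =>
    (subsingleton_propEl _).elim (s i) (t i)⟩) fun x γ y y' g g' hy ⟨s⟩ => ?_
  exact ⟨fun i => ⟨⟨⟩, mem_app_of_profileLE (b i) rfl rfl (s i).2 hy (.refl y')⟩⟩

theorem exists_code_disjTy {Γ : GR ρ Δ} {ι : Type} (b : ι → (Γ ⟶ propObj ρ Δ)) :
    ∃ c : Γ ⟶ propObj ρ Δ,
      Nonempty (disjTy (fun i => reindex (b i) (propEl ρ Δ)) ≅ reindex c (propEl ρ Δ)) := by
  refine exists_code (fun p => ⟨fun s t => Subtype.ext rfl⟩)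
    fun x γ y y' g g' hy ⟨⟨_, i, ⟨s⟩⟩⟩ => ?_
  exact ⟨⟨⟨⟩, i, ⟨⟨⟨⟩, mem_app_of_profileLE (b i) rfl rfl s.2 hy (.refl y')⟩⟩⟩⟩

theorem subsingleton_laterTy (κ : Δ) {Γ : GR ρ Δ} {A : Ty Γ}
    (hA : ∀ p, Subsingleton (A.obj p)) (p : (later κ Γ).Elements) :
    Subsingleton ((laterTy κ A).obj p) :=
  ⟨fun _ _ => Subtype.ext (funext fun _ => funext fun _ => (hA _).elim _ _)⟩

theorem nonempty_laterTy (κ : Δ) {Γ : GR ρ Δ} {A : Ty Γ} (hA : ∀ p, Subsingleton (A.obj p))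
    (p : (later κ Γ).Elements) : Nonempty ((laterTy κ A).obj p) ↔
      ∀ α (hα : α < clockTime κ p.1), Nonempty (A.obj ⟨delay κ p.1 α, p.2.1 α hα⟩) :=
  ⟨fun ⟨s⟩ α hα => ⟨s.1 α hα⟩, fun h => ⟨⟨fun α hα => (h α hα).some,
    fun _ _ _ _ _ => (hA _).elim _ _⟩⟩⟩

/-- The time of `κ` at `y'` is at most that at `y`, so each `α` tested at `y'` was tested at `y`,
and delaying both by `α` preserves the order. -/
theorem exists_code_laterTy_next (κ : Δ) {Γ : GR ρ Δ} (b : Γ ⟶ propObj ρ Δ) :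
    ∃ c : Γ ⟶ propObj ρ Δ, Nonempty
      (reindex (next κ Γ) (laterTy κ (reindex b (propEl ρ Δ))) ≅ reindex c (propEl ρ Δ)) := by
  have hb : ∀ p, Subsingleton ((reindex b (propEl ρ Δ)).obj p) := fun _ => subsingleton_propEl _
  refine exists_code (fun _ => subsingleton_laterTy κ hb _) fun x γ y y' g g' hy hs => ?_
  have hs' := (nonempty_laterTy κ hb _).1 hs
  refine (nonempty_laterTy κ hb _).2 fun α hα => (nonempty_propEl _).2 ?_
  have hm := (nonempty_propEl _).1 (hs' α (lt_of_lt_of_le hα (hy.2 κ)))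
  change delay κ y' α ∈ (b.app _ (Γ.map (toDelay κ y' hα.le) (Γ.map g' γ))).1
  exact mem_app_of_profileLE b (Functor.map_comp_apply Γ g (toDelay κ y (hα.le.trans (hy.2 κ))) γ)
    (Functor.map_comp_apply Γ g' (toDelay κ y' hα.le) γ) hm (hy.delay κ hα.le) (.refl _)

theorem exists_code_laterTy (κ : Δ) {Γ : GR ρ Δ} (b : Γ ⟶ later κ (propObj ρ Δ)) :
    ∃ c : Γ ⟶ propObj ρ Δ,
      Nonempty (reindex b (laterTy κ (propEl ρ Δ)) ≅ reindex c (propEl ρ Δ)) := by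
  refine exists_code (fun _ => subsingleton_laterTy κ subsingleton_propEl _)
    fun x γ y y' g g' hy hs => ?_
  have hs' := (nonempty_laterTy κ subsingleton_propEl _).1 hs
  refine (nonempty_laterTy κ subsingleton_propEl _).2 fun α hα => (nonempty_propEl _).2 ?_
  have hαy : α < clockTime κ y := lt_of_lt_of_le hα (hy.2 κ)
  have hm := (nonempty_propEl _).1 (hs' α hαy)
  -- Here the code at a delayed object need not come from an element of `Γ` there; naturality of `b`
  -- refers it to the set at the delayed `x`.
  have key {z : Base ρ Δ} (k : x ⟶ z) (hz : α < clockTime κ z) (w : Base ρ Δ) :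
      w ∈ ((b.app z (Γ.map k γ)).1 α hz).1 ↔
        w ∈ ((b.app x γ).1 α (hz.trans_le (clockTime_le κ k))).1 ∧
          ProfileLE (delay κ z α) w := by
    have e : b.app z (Γ.map k γ) = (later κ (propObj ρ Δ)).map k (b.app x γ) :=
      NatTrans.naturality_apply b k γ
    rw [e]
    rfl
  exact (key g' hα _).2 ⟨((b.app x γ).1 α _).2.2 _ _ ((key g hαy _).1 hm).1
    (hy.delay κ hα.le), .refl _⟩

theorem exists_code_forallClk [DecidableEq V] (κ : V) {Γ : GR ρ Δ}
    (b : weaken κ Γ ⟶ propObj ρ (insert κ Δ)) :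
    ∃ c : Γ ⟶ propObj ρ Δ,
      Nonempty (forallClk κ (reindex b (propEl ρ (insert κ Δ))) ≅ reindex c (propEl ρ Δ)) := by
  have hb : ∀ r, Subsingleton ((reindex b (propEl ρ (insert κ Δ))).obj r) :=
    fun _ => subsingleton_propEl _
  refine exists_code (subsingleton_piAlong _ hb) fun x γ y y' g g' hy hs => ?_
  have hs' := (nonempty_piAlong _ hb _).1 hs
  refine (nonempty_piAlong _ hb _).2 fun ⟨z, ζ⟩ f => (nonempty_propEl _).2 ?_
  change z ∈ (b.app z ζ).1
  let k : y' ⟶ (CategoryOfElements.map (clkProj ρ Δ κ)).obj z := f.1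
  have hk : Γ.map k (Γ.map g' γ) = ζ := f.2
  -- `w` lies under `y`, where the hypothesis applies, and has the profile of `z`.
  obtain ⟨w, i, j, hi, -⟩ := (hy.trans (ProfileLE.of_hom k)).exists_amalgam_clkProj
  -- The amalgam of `x` with `z` maps to both `z` and `w`: it is the common source.
  obtain ⟨q, i', j', hi', hq⟩ := ((ProfileLE.of_hom g').trans
    (ProfileLE.of_hom k)).exists_amalgam_clkProj
  obtain ⟨r, hr, hr'⟩ := hq z (𝟙 z) (g' ≫ k)
  obtain ⟨l, hl, hl'⟩ := hq w i (g ≫ j)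
  have hm : w ∈ (b.app w (Γ.map j (Γ.map g γ))).1 := (nonempty_propEl _).1
    (hs' ⟨w, Γ.map j (Γ.map g γ)⟩ ⟨j, rfl⟩)
  refine mem_app_of_profileLE b (g := l) (g' := r)
    (γ := (Γ.map j' γ : (weaken κ Γ).obj q)) ?_ ?_ hm hi.profileLE (.refl z)
  · change Γ.map _ (Γ.map j' γ) = _
    rw [← Functor.map_comp_apply, ← Functor.map_comp_apply, hl']
  · change Γ.map _ (Γ.map j' γ) = _
    rw [← Functor.map_comp_apply, hr', Functor.map_comp_apply]
    exact hk

/-- An element of a family over an invariant object comes from the clocks named by a clock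
variable. -/
theorem IsFamily.exists_core {Γ : GR ρ Δ} {A : Ty Γ} (hA : IsFamily A) (hΓ : IsClockInvariant Γ)
    {x y : Base ρ Δ} {γ : Γ.obj x} {δ : Γ.obj y} (g : x ⟶ y) (hg : Γ.map g γ = δ)
    (a : A.obj ⟨y, δ⟩) :
    ∃ (c : Base ρ Δ) (i : c ⟶ y) (ε : Γ.obj c) (h : Γ.map i ε = δ) (a' : A.obj ⟨c, ε⟩),
      IsEmbedding i.1 ∧ (∀ n : c.1.clocks, ∃ d, c.2 d = n) ∧
      A.map (⟨i, h⟩ : Γ.elementsMk c ε ⟶ Γ.elementsMk y δ) a' = a ∧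
      ∀ (w : Base ρ Δ) (t : c ⟶ w) (k : x ⟶ w), Γ.map t ε = Γ.map k γ := by
  obtain ⟨d, j, hj, hd⟩ := ClockModel.exists_core x
  obtain ⟨γ, rfl⟩ := (hΓ.bijective_map j hj).2 γ
  obtain ⟨c, i, hi, hc⟩ := ClockModel.exists_core y
  obtain ⟨l⟩ := (((ProfileLE.of_hom j).trans (ProfileLE.of_hom g)).trans
    hi.profileLE).nonempty_hom hd
  -- Both sides are pushed forward from the core of `x`, out of which morphisms are unique.
  have key (w : Base ρ Δ) (t : c ⟶ w) (k : x ⟶ w) :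
      Γ.map t (Γ.map l γ) = Γ.map k (Γ.map j γ) := by
    rw [← Functor.map_comp_apply, ← Functor.map_comp_apply, hom_ext_of_surjective hd (l ≫ t)]
  have h := (key y i g).trans hg
  obtain ⟨a', ha'⟩ := (hA.bijective_map
    (⟨i, h⟩ : Γ.elementsMk c (Γ.map l γ) ⟶ Γ.elementsMk y δ) hi).2 a
  exact ⟨c, i, _, h, a', hi, hc, ha', key⟩

/-- `γ` lives over `x` and `a` over `c`. Their amalgam carries both, and is a common source for the
pairs over `w` and `w'`. -/
theorem mem_app_compr {Γ₀ Γ : GR ρ Δ} {A : Ty Γ₀} {s : Γ ⟶ Γ₀}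
    (b : compr Γ (reindex s A) ⟶ propObj ρ Δ) {x c : Base ρ Δ} (hx : ProfileLE x c) (γ : Γ.obj x)
    (ε : Γ₀.obj c) (a : A.obj ⟨c, ε⟩)
    (hε : ∀ (w : Base ρ Δ) (t : c ⟶ w) (k : x ⟶ w), Γ₀.map t ε = Γ₀.map k (s.app x γ))
    {w w' : Base ρ Δ} {t : c ⟶ w} {t' : c ⟶ w'} {k : x ⟶ w} {k' : x ⟶ w'}
    {δ : Γ.obj w} {δ' : Γ.obj w'} (hδ : Γ.map k γ = δ) (hδ' : Γ.map k' γ = δ')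
    (ht : Γ₀.map t ε = s.app w δ) (ht' : Γ₀.map t' ε = s.app w' δ')
    (hw : w ∈ (b.app w ⟨δ, A.map (⟨t, ht⟩ : Γ₀.elementsMk c ε ⟶ Γ₀.elementsMk w _) a⟩).1)
    (h : ProfileLE w w') :
    w' ∈ (b.app w' ⟨δ', A.map (⟨t', ht'⟩ : Γ₀.elementsMk c ε ⟶ Γ₀.elementsMk w' _) a⟩).1 := by
  obtain ⟨q, i, j, hi, hq⟩ := hx.exists_amalgam
  have hqε : Γ₀.map i ε = s.app q (Γ.map j γ) :=
    (hε q i j).trans (NatTrans.naturality_apply s j γ).symm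
  let ξ : (compr Γ (reindex s A)).obj q :=
    ⟨Γ.map j γ, A.map (⟨i, hqε⟩ : Γ₀.elementsMk c ε ⟶ Γ₀.elementsMk q _) a⟩
  have key {v : Base ρ Δ} (t : c ⟶ v) (k : x ⟶ v) (δ : Γ.obj v) (hδ : Γ.map k γ = δ)
      (ht : Γ₀.map t ε = s.app v δ) : ∃ r : q ⟶ v, (compr Γ (reindex s A)).map r ξ =
        ⟨δ, A.map (⟨t, ht⟩ : Γ₀.elementsMk c ε ⟶ Γ₀.elementsMk v _) a⟩ := by
    obtain ⟨r, rfl, rfl⟩ := hq v t k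
    have hr : Γ.map r (Γ.map j γ) = δ := (Functor.map_comp_apply _ _ _ _).symm.trans hδ
    refine ⟨r, (compr_map r hr _).trans (Sigma.ext rfl (heq_of_eq ?_))⟩
    exact (A.map_comp_apply _ _ a).symm
  obtain ⟨r, hr⟩ := key t k δ hδ ht
  obtain ⟨r', hr'⟩ := key t' k' δ' hδ' ht'
  exact mem_app_of_profileLE b hr hr' hw h (.refl w')

/-- A witness at `y` descends to the core of `y`, and its image along the morphism from there to
`y'` is a witness at `y'`. -/
theorem exists_code_existsTy {Γ₀ Γ : GR ρ Δ} {A : Ty Γ₀} (hΓ : IsClockInvariant Γ₀)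
    (hA : IsFamily A) (s : Γ ⟶ Γ₀) (b : compr Γ (reindex s A) ⟶ propObj ρ Δ) :
    ∃ c : Γ ⟶ propObj ρ Δ, Nonempty
      (existsTy (reindex s A) (reindex b (propEl ρ Δ)) ≅ reindex c (propEl ρ Δ)) := by
  refine exists_code (fun p => ⟨fun s t => Subtype.ext rfl⟩)
    fun x γ y y' g g' hy ⟨⟨_, a, hm⟩⟩ => ?_
  change A.obj ⟨y, s.app y (Γ.map g γ)⟩ at a
  replace hm : y ∈ (b.app y ⟨Γ.map g γ, a⟩).1 := (nonempty_propEl _).1 hm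
  obtain ⟨c, i, ε, h, a, hi, hc, rfl, hε⟩ := hA.exists_core hΓ g
    (NatTrans.naturality_apply s g γ).symm a
  obtain ⟨m⟩ := ((ProfileLE.of_hom i).trans hy).nonempty_hom hc
  have hm' : Γ₀.map m ε = s.app y' (Γ.map g' γ) :=
    (hε y' m g').trans (NatTrans.naturality_apply s g' γ).symm
  exact ⟨⟨⟨⟩, A.map (⟨m, hm'⟩ : Γ₀.elementsMk c ε ⟶ Γ₀.elementsMk y' _) a, (nonempty_propEl _).2
    (mem_app_compr b ((ProfileLE.of_hom g).trans hi.profileLE) γ ε a hε rfl rfl h hm' hm hy)⟩⟩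

theorem exists_code_forallTy {Γ₀ Γ : GR ρ Δ} {A : Ty Γ₀} (hΓ : IsClockInvariant Γ₀)
    (hA : IsFamily A) (s : Γ ⟶ Γ₀) (b : compr Γ (reindex s A) ⟶ propObj ρ Δ) :
    ∃ c : Γ ⟶ propObj ρ Δ, Nonempty
      (forallTy (reindex s A) (reindex b (propEl ρ Δ)) ≅ reindex c (propEl ρ Δ)) := by
  have hb : ∀ r, Subsingleton ((reindex b (propEl ρ Δ)).obj r) := fun _ => subsingleton_propEl _
  refine exists_code (subsingleton_piAlong _ hb) fun x γ y y' g g' hy hs => ?_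
  have hs' := (nonempty_piAlong _ hb _).1 hs
  refine (nonempty_piAlong _ hb _).2 fun ⟨v, δ, a⟩ f => (nonempty_propEl _).2 ?_
  let k : y' ⟶ v := f.1
  have hk : Γ.map k (Γ.map g' γ) = δ := f.2
  clear_value k
  clear f
  change A.obj ⟨v, s.app v δ⟩ at a
  change v ∈ (b.app v ⟨δ, a⟩).1
  have hδ : Γ.map (g' ≫ k) γ = δ := (Functor.map_comp_apply _ _ _ _).trans hk
  obtain ⟨c, i, ε, h, a, hi, hc, rfl, hε⟩ := hA.exists_core hΓ (g' ≫ k) (γ := s.app x γ)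
    ((NatTrans.naturality_apply s _ γ).symm.trans (congrArg (s.app v) hδ)) a
  -- The core `c` of `v` carries the instance `a`. Its amalgam with `y` lies under `y`, where the
  -- hypothesis applies, and has the profile of `v`.
  obtain ⟨w, t, j, ht, -⟩ := ((hy.trans (ProfileLE.of_hom k)).trans hi.profileLE).exists_amalgam
  have hw : Γ₀.map t ε = s.app w (Γ.map j (Γ.map g γ)) := by
    rw [← Functor.map_comp_apply, NatTrans.naturality_apply]
    exact hε w t (g ≫ j)
  have hm : w ∈ (b.app w ⟨Γ.map j (Γ.map g γ),
      A.map (⟨t, hw⟩ : Γ₀.elementsMk c ε ⟶ Γ₀.elementsMk w _) a⟩).1 :=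
    (nonempty_propEl _).1 (hs' ⟨w, _, _⟩ ⟨j, rfl⟩)
  exact mem_app_compr b (((ProfileLE.of_hom g').trans (ProfileLE.of_hom k)).trans hi.profileLE)
    γ ε a hε (Functor.map_comp_apply Γ g j γ) hδ hw h hm (ht.profileLE.trans (.of_hom i))

end Universe
end ClockModel

theorem proposition4p2 (ρ : Ordinal.{u}) (hρ : Order.IsSuccLimit ρ)
    (V : Type u) [DecidableEq V] :
    ∃ (P : ∀ Δ : Finset V, GR ρ Δ) (El : ∀ Δ : Finset V, Ty (P Δ)), ∀ Δ : Finset V,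
      -- `El Δ` is a predicate on `P Δ`, which is invariant under clock introduction
      IsPredicate (El Δ) ∧ IsClockInvariant (P Δ) ∧
      -- predicates on invariant objects have a unique code
      (∀ (Γ : GR ρ Δ) (A : Ty Γ), IsClockInvariant Γ → IsPredicate A →
        ∃! c : Γ ⟶ P Δ, Nonempty (A ≅ reindex c (El Δ))) ∧
      -- over an arbitrary object, a code is determined by the predicate it encodes
      (∀ (Γ : GR ρ Δ) (c d : Γ ⟶ P Δ),
        Nonempty (reindex c (El Δ) ≅ reindex d (El Δ)) → c = d) ∧
      -- universal and existential quantification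
      (∀ (Γ₀ : GR ρ Δ) (A : Ty Γ₀), IsClockInvariant Γ₀ → IsFamily A →
        ∀ (Γ : GR ρ Δ) (s : Γ ⟶ Γ₀) (b : compr Γ (reindex s A) ⟶ P Δ),
          (∃ c : Γ ⟶ P Δ, Nonempty
            (forallTy (reindex s A) (reindex b (El Δ)) ≅ reindex c (El Δ))) ∧
          (∃ c : Γ ⟶ P Δ, Nonempty
            (existsTy (reindex s A) (reindex b (El Δ)) ≅ reindex c (El Δ)))) ∧
      -- finite conjunctions and disjunctions
      (∀ (Γ : GR ρ Δ) (ι : Type) [Finite ι] (b : ι → (Γ ⟶ P Δ)),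
        (∃ c : Γ ⟶ P Δ, Nonempty (conjTy (fun i => reindex (b i) (El Δ)) ≅ reindex c (El Δ))) ∧
        (∃ c : Γ ⟶ P Δ, Nonempty (disjTy (fun i => reindex (b i) (El Δ)) ≅ reindex c (El Δ)))) ∧
      -- universal quantification over clocks
      (∀ (κ : V), κ ∉ Δ → ∀ (Γ : GR ρ Δ) (b : weaken κ Γ ⟶ P (insert κ Δ)),
        ∃ c : Γ ⟶ P Δ, Nonempty
          (forallClk κ (reindex b (El (insert κ Δ))) ≅ reindex c (El Δ))) ∧
      -- the modality `▷^κ`, first on predicates over `Γ`, then on predicates given by a map into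
      -- `▷^κ (P Δ)`
      (∀ (κ : Δ) (Γ : GR ρ Δ),
        (∀ b : Γ ⟶ P Δ, ∃ c : Γ ⟶ P Δ, Nonempty
          (reindex (next κ Γ) (laterTy κ (reindex b (El Δ))) ≅ reindex c (El Δ))) ∧
        (∀ b : Γ ⟶ later κ (P Δ), ∃ c : Γ ⟶ P Δ, Nonempty
          (reindex b (laterTy κ (El Δ)) ≅ reindex c (El Δ)))) := by
  refine ⟨propObj ρ, propEl ρ, fun Δ => ⟨isPredicate_propEl, isClockInvariant_propObj,
    fun Γ A hΓ hA => ?_, fun Γ c d => eq_of_reindex_iso, fun Γ₀ A hΓ hA Γ s b =>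
      ⟨exists_code_forallTy hΓ hA s b, exists_code_existsTy hΓ hA s b⟩,
    fun Γ ι _ b => ⟨exists_code_conjTy b, exists_code_disjTy b⟩,
    fun κ _ Γ b => exists_code_forallClk κ b,
    fun κ Γ => ⟨exists_code_laterTy_next κ, exists_code_laterTy κ⟩⟩⟩
  obtain ⟨c, ⟨e⟩⟩ := exists_code_of_isPredicate hΓ hA
  exact ⟨c, ⟨e⟩, fun d ⟨e'⟩ => eq_of_reindex_iso ⟨e'.symm ≪≫ e⟩⟩
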